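/- Let $T$ be a not necessarily associative unital ring, let $G$ be an abelian group with identity element $e$, and let $\sigma : G \to \mathrm{Aut}(T)$, $g \mapsto \sigma_g$, be a group homomorphism. Let $R = T \rtimes_\sigma G$ be the non-associative skew group ring, i.e. the set of finite formal sums $\sum_{g \in G} t_g u_g$ with $t_g \in T$, with coordinate-wise addition and with the multiplication defined by bi-additive extension of $(a u_g)(b u_h) = a\,\sigma_g(b)\, u_{gh}$ for $a,b \in T$, $g,h \in G$. All ideals are two-sided. A ring is simple if it is non-zero and its only ideals are $\{0\}$ and the ring itself. The ring $T$ is called $G$-simple if it is non-zero and the only ideals $I$ of $T$ with $\sigma_g(I) \subseteq I$ for all $g \in G$ are $\{0\}$ and $T$. The nucleus $N(T)$ is the set of all $r \in T$ such that $(rs)t = r(st)$, $(sr)t = s(rt)$ and $(st)r = s(tr)$ for all $s,t \in T$; it is an associative unital subring of $T$. The center $Z(R)$ is the set of elements of $N(R)$ that commute with every element of $R$; it is an associative and commutative unital ring. Put $N(T)^G = \{ r \in N(T) \mid \sigma_g(r) = r \text{ for all } g \in G\}$ and let $L$ be the subgroup of $G$ consisting of all $g \in G$ for which there is an invertible element $u$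 of the ring $N(T)^G$ with $\sigma_g(t) = u t u^{-1}$ for all $t \in T$. Then: (a) $R$ is simple if and only if $T$ is $G$-simple, $Z(R)$ is an integral domain, and $L$ is a torsion group. (b) If $T$ is commutative (i.e. $ab = ba$ for all $a,b \in T$), then $R$ is simple if and only if $T$ is $G$-simple and $L = \{e\}$. -/

import Mathlib

/-! ### Nucleus, invariants and `G`-simplicity -/

namespace NASkew

/-- The nucleus `N(T)` of a not necessarily associative unital ring: the intersection of the left,
middle and right nuclei. -/
def nucleus (T : Type*) [NonAssocRing T] : Subring T where
  carrier := {r | (∀ s t, associator r s t = 0) ∧ (∀ s t, associator s r t = 0) ∧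
    (∀ s t, associator s t r = 0)}
  zero_mem' := by simp [associator]
  one_mem' := by simp [associator]
  add_mem' := by
    rintro a b ⟨h1, h2, h3⟩ ⟨k1, k2, k3⟩
    simp only [associator, sub_eq_zero] at h1 h2 h3 k1 k2 k3
    refine ⟨fun s t => ?_, fun s t => ?_, fun s t => ?_⟩ <;>
      simp only [associator, sub_eq_zero, add_mul, mul_add, h1, h2, h3, k1, k2, k3]
  neg_mem' := by
    rintro a ⟨h1, h2, h3⟩
    simp only [associator, sub_eq_zero] at h1 h2 h3
    refine ⟨fun s t => ?_, fun s t => ?_, fun s t => ?_⟩ <;>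
      simp only [associator, sub_eq_zero, neg_mul, mul_neg, h1, h2, h3]
  mul_mem' := by
    rintro a b ⟨h1, h2, h3⟩ ⟨k1, k2, k3⟩
    simp only [associator, sub_eq_zero] at h1 h2 h3 k1 k2 k3
    refine ⟨fun s t => ?_, fun s t => ?_, fun s t => ?_⟩ <;>
      simp only [associator, sub_eq_zero]
    · rw [h1, h1, h1, k1]
    · rw [← h2, k2, h2, ← h1]
    · rw [← k3, h3, k3, k3]

theorem mem_nucleus {T : Type*} [NonAssocRing T] {r : T} :
    r ∈ nucleus T ↔ (∀ s t, (r * s) * t = r * (s * t)) ∧ (∀ s t, (s * r) * t = s * (r * t)) ∧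
      (∀ s t, (s * t) * r = s * (t * r)) := by
  change (_ ∧ _ ∧ _) ↔ _
  simp only [associator, sub_eq_zero]

/-- The subring `N(T)^G` of `G`-fixed elements of the nucleus. -/
def nucleusFixed {T G : Type*} [NonAssocRing T] [Group G] (σ : G →* RingAut T) : Subring T where
  carrier := {r | r ∈ nucleus T ∧ ∀ g, σ g r = r}
  zero_mem' := ⟨zero_mem _, fun g => map_zero (σ g)⟩
  one_mem' := ⟨one_mem _, fun g => map_one (σ g)⟩
  add_mem' := fun ha hb => ⟨add_mem ha.1 hb.1, fun g => by rw [map_add, ha.2, hb.2]⟩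
  neg_mem' := fun ha => ⟨neg_mem ha.1, fun g => by rw [map_neg, ha.2]⟩
  mul_mem' := fun ha hb => ⟨mul_mem ha.1 hb.1, fun g => by rw [map_mul, ha.2, hb.2]⟩

/-- `T` is `G`-simple: it is non-zero and its only `G`-invariant (two-sided) ideals are
`{0}` and `T`. -/
def IsGSimple {T G : Type*} [NonAssocRing T] [Group G] (σ : G →* RingAut T) : Prop :=
  Nontrivial T ∧
    ∀ I : TwoSidedIdeal T, (∀ (g : G) (t : T), t ∈ I → σ g t ∈ I) → I = ⊥ ∨ I = ⊤

/-- The subgroup `L` of those `g ∈ G` for which `σ_g` is conjugation `t ↦ u t u⁻¹` by an invertible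
element `u` of the associative ring `N(T)^G` (below, `v` is the inverse of `u`). -/
def conjSubgroup {T G : Type*} [NonAssocRing T] [Group G] (σ : G →* RingAut T) : Subgroup G where
  carrier := {g | ∃ u ∈ nucleusFixed σ, ∃ v ∈ nucleusFixed σ,
    u * v = 1 ∧ v * u = 1 ∧ ∀ t, σ g t = u * t * v}
  one_mem' := ⟨1, one_mem _, 1, one_mem _, by simp, by simp, by simp⟩
  mul_mem' := by
    rintro g h ⟨u, hu, v, hv, huv, hvu, H⟩ ⟨x, hx, y, hy, hxy, hyx, K⟩
    obtain ⟨u1, u2, u3⟩ := mem_nucleus.1 hu.1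
    obtain ⟨v1, v2, v3⟩ := mem_nucleus.1 hv.1
    obtain ⟨x1, x2, x3⟩ := mem_nucleus.1 hx.1
    obtain ⟨y1, y2, y3⟩ := mem_nucleus.1 hy.1
    refine ⟨u * x, mul_mem hu hx, y * v, mul_mem hy hv, ?_, ?_, fun t => ?_⟩
    · rw [u1, ← x1, hxy, one_mul, huv]
    · rw [y1, ← v1, hvu, one_mul, hyx]
    · rw [map_mul, RingAut.mul_apply, K, H]
      simp only [u1, x1, v3]
  inv_mem' := by
    rintro g ⟨u, hu, v, hv, huv, hvu, H⟩
    obtain ⟨u1, u2, u3⟩ := mem_nucleus.1 hu.1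
    obtain ⟨v1, v2, v3⟩ := mem_nucleus.1 hv.1
    refine ⟨v, hv, u, hu, hvu, huv, fun t => ?_⟩
    apply (σ g).injective
    rw [← RingAut.mul_apply, ← map_mul, mul_inv_cancel, map_one, RingAut.one_apply, H]
    rw [← u1, ← u1, huv, one_mul, u2, huv, mul_one]

end NASkew

/-! ### The skew group ring -/

/-- The non-associative skew group ring `T ⋊_σ G`: its elements are the finite sums
`∑ t_g u_g`, added coordinate-wise and multiplied by `(a u_g) (b u_h) = a σ_g(b) u_{gh}`. -/
def SkewGroupRing {T G : Type*} [NonAssocRing T] [Group G] (_σ : G →* RingAut T) : Type _ :=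
  G →₀ T

namespace SkewGroupRing

variable {T G : Type*} [NonAssocRing T] [Group G] (σ : G →* RingAut T)

noncomputable instance : AddCommGroup (SkewGroupRing σ) :=
  inferInstanceAs (AddCommGroup (G →₀ T))

/-- The homogeneous element `t u_g`. -/
noncomputable def single (g : G) (t : T) : SkewGroupRing σ := Finsupp.single g t

/-- The multiplication, as a bi-additive map. -/
noncomputable def mulHom : (G →₀ T) →+ (G →₀ T) →+ (G →₀ T) :=
  Finsupp.liftAddHom fun g =>
    AddMonoidHom.flip <| Finsupp.liftAddHom fun h =>
      AddMonoidHom.flip <|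
        (AddMonoidHom.compr₂ AddMonoidHom.mul (Finsupp.singleAddHom (g * h))).compl₂
          ((σ g : T ≃+* T) : T →+ T)

theorem mulHom_single (g h : G) (a b : T) :
    mulHom σ (Finsupp.single g a) (Finsupp.single h b) = Finsupp.single (g * h) (a * σ g b) := by
  simp [mulHom]

noncomputable instance : NonAssocRing (SkewGroupRing σ) where
  mul x y := mulHom σ x y
  one := Finsupp.single 1 1
  left_distrib x y z := map_add (mulHom σ x) y z
  right_distrib x y z := by
    exact DFunLike.congr_fun (map_add (mulHom σ) x y) z
  zero_mul x := by
    exact DFunLike.congr_fun (map_zero (mulHom σ)) x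
  mul_zero x := map_zero (mulHom σ x)
  one_mul x := by
    change mulHom σ (Finsupp.single 1 1) x = x
    have : mulHom σ (Finsupp.single 1 1) = AddMonoidHom.id (G →₀ T) :=
      Finsupp.addHom_ext fun h b => by rw [mulHom_single]; simp
    rw [this]; rfl
  mul_one x := by
    change mulHom σ x (Finsupp.single 1 1) = x
    have : (mulHom σ).flip (Finsupp.single 1 1) = AddMonoidHom.id (G →₀ T) :=
      Finsupp.addHom_ext fun h b => by
        rw [AddMonoidHom.flip_apply, mulHom_single]; simp
    exact DFunLike.congr_fun this x

theorem single_mul_single (g h : G) (a b : T) :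
    single σ g a * single σ h b = single σ (g * h) (a * σ g b) :=
  mulHom_single σ g h a b

theorem one_def : (1 : SkewGroupRing σ) = single σ 1 1 := rfl

/-- The center of a non-associative ring (elements that commute and associate with everything) is
an associative commutative ring. -/
noncomputable instance : CommRing (Subring.center (SkewGroupRing σ)) where
  __ := (inferInstance : NonAssocRing (Subring.center (SkewGroupRing σ)))
  mul_comm a b := Subtype.ext (a.2.comm b.1)
  mul_assoc a b c := Subtype.ext (a.2.left_assoc b.1 c.1).symm

end SkewGroupRing

/-! Since `G` is abelian, the centre of `R` is graded: `x` is central exactly when each `x_g` lies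
in `N(T)^G` and satisfies `t x_g = x_g σ_g(t)`. If `T` is `G`-simple, a non-zero such `x_g` is
invertible, because `x_g T` is an invariant ideal. So the degrees occurring in the centre lie in
`L`, and non-zero homogeneous central elements are units.

If `R` is simple, every non-zero central `z` is invertible, as `zR` is an ideal. Zero divisors in
the centre are thus excluded, and so is a `g ∈ L` of infinite order, for which some central `1 + a
u_g` has no inverse. For commutative `T`, the element `u_g - 1` plays this role for any `g ≠ e` in
`L`.

Conversely, minimal support puts a non-zero central element in each non-zero ideal
(`exists_mem_center_of_ne_bot`). If `L` is torsion, the centre is integral over the field of its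
degree-one elements (`isIntegral_centerDegreeOne`); being a domain, it is a field, so the ideal
contains a unit. If `L` is trivial, the centre equals that field. -/

namespace NASkew

/-! ### Twisted central elements of `T` -/

variable {T G : Type*} [NonAssocRing T] [CommGroup G] {σ : G →* RingAut T}

/-- `a` is a `G`-fixed element of the nucleus with `t a = a σ_g(t)` for all `t`; these are exactly
the elements for which `a u_g` is central in the skew group ring. -/
structure IsTwistedCentral (σ : G →* RingAut T) (g : G) (a : T) : Prop where
  mem : a ∈ nucleusFixed σ
  comm : ∀ t, t * a = a * σ g t

theorem IsTwistedCentral.exists_inverse (hT : IsGSimple σ) {g : G} {a : T}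
    (ha : IsTwistedCentral σ g a) (h0 : a ≠ 0) : ∃ b, a * b = 1 ∧ b * a = 1 := by
  obtain ⟨h1, h2, h3⟩ := mem_nucleus.1 ha.mem.1
  let I : TwoSidedIdeal T := TwoSidedIdeal.mk' {x | ∃ t, x = a * t} ⟨0, by simp⟩
    (by rintro _ _ ⟨s, rfl⟩ ⟨t, rfl⟩; exact ⟨s + t, by rw [mul_add]⟩)
    (by rintro _ ⟨s, rfl⟩; exact ⟨-s, by rw [mul_neg]⟩)
    (by rintro x _ ⟨s, rfl⟩; exact ⟨σ g x * s, by rw [← h2, ha.comm, h1]⟩)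
    (by rintro _ y ⟨s, rfl⟩; exact ⟨s * y, by rw [h1]⟩)
  have hI : ∀ x, x ∈ I ↔ ∃ t, x = a * t := fun x => TwoSidedIdeal.mem_mk' _ _ _ _ _ _ _
  rcases hT.2 I (by
    intro h t ht
    obtain ⟨s, rfl⟩ := (hI t).1 ht
    exact (hI _).2 ⟨σ h s, by rw [map_mul, ha.mem.2]⟩) with h | h
  · refine absurd ?_ h0
    have : a ∈ I := (hI a).2 ⟨1, by simp⟩
    rw [h] at this
    exact (TwoSidedIdeal.mem_bot T).1 this
  · obtain ⟨b, hb⟩ := (hI 1).1 (I.one_mem h)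
    obtain ⟨c, hc⟩ := (σ g).surjective b
    have hca : c * a = 1 := by rw [ha.comm, hc, hb]
    -- The one-sided inverses agree because `a` lies in the middle nucleus.
    have : c = b := by
      rw [← mul_one c, hb, ← h2, hca, one_mul]
    exact ⟨b, hb.symm, this ▸ hca⟩

/-- Multiplication by the nuclear element `a` is cancellable on both sides, so identities for `b`
can be checked after multiplying by `a`. -/
theorem IsTwistedCentral.inverse {g : G} {a b : T} (ha : IsTwistedCentral σ g a)
    (hab : a * b = 1) (hba : b * a = 1) : IsTwistedCentral σ g⁻¹ b := by
  obtain ⟨h1, h2, h3⟩ := mem_nucleus.1 ha.mem.1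
  have cl : ∀ t, a * (b * t) = t := fun t => by rw [← h1, hab, one_mul]
  have cl' : ∀ x y, a * x = a * y → x = y := fun x y h => by
    rw [← one_mul x, ← hba, h2, h, ← h2, hba, one_mul]
  have cr : ∀ t, (t * b) * a = t := fun t => by rw [h3, hba, mul_one]
  have cm : ∀ t, (t * a) * b = t := fun t => by rw [h2, hab, mul_one]
  have cr' : ∀ x y, x * a = y * a → x = y := fun x y h => by
    rw [← cm x, h, cm]
  refine ⟨⟨mem_nucleus.2 ⟨fun s t => ?_, fun s t => ?_, fun s t => ?_⟩, fun h => ?_⟩, fun t => ?_⟩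
  · apply cl'
    rw [cl, ← h1, cl]
  · rw [← cl t, ← h2, cr, cl]
  · apply cr'
    rw [cr, h3, cr]
  · apply cl'
    rw [hab]
    conv_lhs => rw [← ha.mem.2 h, ← map_mul, hab, map_one]
  · apply cr'
    apply cl'
    rw [cr, ← h3, cl, ha.comm, ← RingAut.mul_apply, ← map_mul, mul_inv_cancel, map_one,
      RingAut.one_apply]

theorem IsTwistedCentral.mem_conjSubgroup (hT : IsGSimple σ) {g : G} {a : T}
    (ha : IsTwistedCentral σ g a) (h0 : a ≠ 0) : g ∈ conjSubgroup σ := by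
  obtain ⟨b, hab, hba⟩ := ha.exists_inverse hT h0
  have hb := ha.inverse hab hba
  -- The conjugator is `a⁻¹`: the twisted relation says `σ_g(t) = a⁻¹ t a`.
  refine ⟨b, hb.mem, a, ha.mem, hba, hab, fun t => ?_⟩
  rw [(mem_nucleus.1 hb.mem.1).1, ha.comm, ← (mem_nucleus.1 hb.mem.1).1, hba, one_mul]

end NASkew

/-! ### Coefficients and the graded description of the centre -/

namespace SkewGroupRing

open NASkew

variable {T G : Type*} [NonAssocRing T] [CommGroup G] (σ : G →* RingAut T)

/-- The coefficient at `u_h`. -/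
noncomputable def coeff (h : G) : SkewGroupRing σ →+ T := Finsupp.applyAddHom h

variable {σ}

theorem ext {x y : SkewGroupRing σ} (h : ∀ g, coeff σ g x = coeff σ g y) : x = y :=
  Finsupp.ext h

theorem coeff_single_self (g : G) (a : T) : coeff σ g (single σ g a) = a :=
  Finsupp.single_eq_same

theorem coeff_single_of_ne {g h : G} (a : T) (hg : h ≠ g) : coeff σ h (single σ g a) = 0 :=
  Finsupp.single_eq_of_ne hg

theorem coeff_one_self : coeff σ 1 (1 : SkewGroupRing σ) = 1 := coeff_single_self 1 1

theorem coeff_one_of_ne {g : G} (hg : g ≠ 1) : coeff σ g (1 : SkewGroupRing σ) = 0 :=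
  coeff_single_of_ne 1 hg

theorem single_zero (g : G) : single σ g 0 = 0 := Finsupp.single_zero g

theorem single_add (g : G) (a b : T) : single σ g (a + b) = single σ g a + single σ g b :=
  Finsupp.single_add g a b

theorem finite_coeff_ne_zero (x : SkewGroupRing σ) : {g | coeff σ g x ≠ 0}.Finite :=
  Finsupp.hasFiniteSupport x

@[elab_as_elim]
theorem induction_on {p : SkewGroupRing σ → Prop} (x : SkewGroupRing σ) (zero : p 0)
    (add : ∀ x y, p x → p y → p (x + y)) (single : ∀ g a, p (single σ g a)) : p x :=
  Finsupp.induction_linear x zero (fun x y => add x y) single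

theorem coeff_single_mul (g h : G) (a : T) (x : SkewGroupRing σ) :
    coeff σ h (single σ g a * x) = a * σ g (coeff σ (g⁻¹ * h) x) := by
  induction x using induction_on with
  | zero => simp
  | add x y hx hy => simp only [mul_add, map_add, hx, hy]
  | single k b =>
    rw [single_mul_single]
    by_cases hk : h = g * k
    · subst hk
      rw [coeff_single_self, inv_mul_cancel_left, coeff_single_self]
    · rw [coeff_single_of_ne _ hk, coeff_single_of_ne, map_zero, mul_zero]
      rintro rfl
      simp at hk

theorem coeff_mul_single (g h : G) (a : T) (x : SkewGroupRing σ) :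
    coeff σ h (x * single σ g a) = coeff σ (h * g⁻¹) x * σ (h * g⁻¹) a := by
  induction x using induction_on with
  | zero => simp
  | add x y hx hy => simp only [add_mul, map_add, hx, hy]
  | single k b =>
    rw [single_mul_single]
    by_cases hk : h = k * g
    · subst hk
      rw [coeff_single_self, mul_inv_cancel_right, coeff_single_self]
    · rw [coeff_single_of_ne _ hk, coeff_single_of_ne, zero_mul]
      rintro rfl
      simp at hk

theorem coeff_single_one_mul (h : G) (a : T) (x : SkewGroupRing σ) :
    coeff σ h (single σ 1 a * x) = a * coeff σ h x := by
  simp [coeff_single_mul]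

theorem coeff_mul_single_one (h : G) (a : T) (x : SkewGroupRing σ) :
    coeff σ h (x * single σ 1 a) = coeff σ h x * σ h a := by
  simp [coeff_mul_single]

/-- Commutativity of `G` makes conjugation by `u_g` preserve degrees. -/
theorem coeff_conj (g h : G) (x : SkewGroupRing σ) :
    coeff σ h (single σ g 1 * x * single σ g⁻¹ 1) = σ g (coeff σ h x) := by
  simp [coeff_mul_single, coeff_single_mul, mul_comm h g]

theorem single_mem_center {g : G} {a : T} (ha : IsTwistedCentral σ g a) :
    single σ g a ∈ Subring.center (SkewGroupRing σ) := by
  obtain ⟨h1, h2, h3⟩ := mem_nucleus.1 ha.mem.1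
  have hσ : ∀ g h t, σ (g * h) t = σ g (σ h t) := fun g h t => by rw [map_mul, RingAut.mul_apply]
  refine Set.mem_center_iff.2 ⟨fun x => ?_, fun x y => ?_, fun x y => ?_⟩
  · rw [commute_iff_eq]
    induction x using induction_on with
    | zero => simp
    | add x y hx hy => rw [mul_add, add_mul, hx, hy]
    | single h b =>
      rw [single_mul_single, single_mul_single, ha.mem.2, ha.comm, mul_comm g h]
  · induction x using induction_on with
    | zero => simp
    | add x x' hx hx' => simp only [mul_add, add_mul, hx, hx']
    | single h b =>
      induction y using induction_on with
      | zero => simp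
      | add x x' hx hx' => simp only [mul_add, hx, hx']
      | single k c =>
        simp only [single_mul_single]
        rw [map_mul, h1, hσ, mul_assoc]
  · induction x using induction_on with
    | zero => simp
    | add x x' hx hx' => simp only [add_mul, hx, hx']
    | single h b =>
      induction y using induction_on with
      | zero => simp
      | add x x' hx hx' => simp only [mul_add, add_mul, hx, hx']
      | single k c =>
        simp only [single_mul_single]
        rw [ha.mem.2, ha.mem.2, map_mul, ha.mem.2, h3, mul_assoc]

theorem eq_sum_single (x : SkewGroupRing σ) :
    x = ∑ g ∈ (finite_coeff_ne_zero x).toFinset, single σ g (coeff σ g x) :=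
  (Finsupp.sum_single x).symm.trans <| Finset.sum_congr
    (by ext; exact Finsupp.mem_support_iff.trans (by simp; rfl)) fun _ _ => rfl

theorem mem_center_of_coeff {x : SkewGroupRing σ} (hx : ∀ g, IsTwistedCentral σ g (coeff σ g x)) :
    x ∈ Subring.center (SkewGroupRing σ) := by
  rw [eq_sum_single x]
  exact sum_mem fun g _ => single_mem_center (hx g)

/-- The coefficients of `x` are twisted central if suitable commutators, associators and conjugates
vanish. -/
theorem isTwistedCentral_coeff {x : SkewGroupRing σ}
    (conj : ∀ g, single σ g 1 * x * single σ g⁻¹ 1 = x)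
    (comm : ∀ t, single σ 1 t * x = x * single σ 1 t)
    (left : ∀ s t, x * single σ 1 s * single σ 1 t = x * (single σ 1 s * single σ 1 t))
    (mid : ∀ s t, single σ 1 s * x * single σ 1 t = single σ 1 s * (x * single σ 1 t))
    (right : ∀ s t, single σ 1 s * single σ 1 t * x = single σ 1 s * (single σ 1 t * x)) (g : G) :
    IsTwistedCentral σ g (coeff σ g x) := by
  refine ⟨⟨mem_nucleus.2 ⟨fun s t => ?_, fun s t => ?_, fun s t => ?_⟩, fun h => ?_⟩, fun t => ?_⟩
  -- Moving a degree-one factor past `u_g` applies `σ_g`, so the test elements are taken in the form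
  -- `σ_g(s)`.
  · obtain ⟨s, rfl⟩ := (σ g).surjective s
    obtain ⟨t, rfl⟩ := (σ g).surjective t
    have := congrArg (coeff σ g) (left s t)
    simpa [coeff_mul_single_one, single_mul_single] using this
  · obtain ⟨t, rfl⟩ := (σ g).surjective t
    have := congrArg (coeff σ g) (mid s t)
    simpa [coeff_mul_single_one, coeff_single_one_mul] using this
  · have := congrArg (coeff σ g) (right s t)
    simpa [coeff_single_one_mul, single_mul_single] using this
  · rw [← coeff_conj, conj]
  · rw [← coeff_single_one_mul, comm, coeff_mul_single_one]

theorem isTwistedCentral_coeff_of_mem_center {x : SkewGroupRing σ}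
    (hx : x ∈ Subring.center (SkewGroupRing σ)) (g : G) :
    IsTwistedCentral σ g (coeff σ g x) := by
  have h : IsMulCentral x := hx
  refine isTwistedCentral_coeff (fun g => ?_) (fun t => (h.comm _).eq.symm)
    (fun s t => (h.left_assoc _ _).symm) (fun s t => h.mid_assoc _ _)
    (fun s t => h.right_assoc _ _) g
  rw [← (h.comm _).eq, ← h.left_assoc, single_mul_single]
  simp [← one_def]

/-! ### Consequences of simplicity -/

theorem nontrivial_of_isSimpleRing [IsSimpleRing (SkewGroupRing σ)] : Nontrivial T := by
  by_contra h
  rw [not_nontrivial_iff_subsingleton] at h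
  have h0 : ∀ x : SkewGroupRing σ, x = 0 := fun x => ext fun _ => Subsingleton.elim _ _
  obtain ⟨I, J, hIJ⟩ := exists_pair_ne (TwoSidedIdeal (SkewGroupRing σ))
  exact hIJ (TwoSidedIdeal.ext fun x => by simp only [h0 x, I.zero_mem, J.zero_mem])

/-- An invariant ideal `I` of `T` extends to the ideal of elements with all coefficients in `I`, and
is recovered in degree one. -/
theorem isGSimple_of_isSimpleRing [IsSimpleRing (SkewGroupRing σ)] : IsGSimple σ := by
  refine ⟨nontrivial_of_isSimpleRing (σ := σ), fun I hI => ?_⟩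
  let J : TwoSidedIdeal (SkewGroupRing σ) := TwoSidedIdeal.mk' {x | ∀ g, coeff σ g x ∈ I}
    (fun g => by rw [map_zero]; exact I.zero_mem)
    (fun hx hy g => by rw [map_add]; exact I.add_mem (hx g) (hy g))
    (fun hx g => by rw [map_neg]; exact I.neg_mem (hx g))
    (by
      intro x y hy g
      induction x using induction_on with
      | zero => rw [zero_mul, map_zero]; exact I.zero_mem
      | add x x' hx hx' => rw [add_mul, map_add]; exact I.add_mem hx hx'
      | single h b =>
        rw [coeff_single_mul]
        exact I.mul_mem_left _ _ (hI _ _ (hy _)))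
    (by
      intro y x hy g
      induction x using induction_on with
      | zero => rw [mul_zero, map_zero]; exact I.zero_mem
      | add x x' hx hx' => rw [mul_add, map_add]; exact I.add_mem hx hx'
      | single h b =>
        rw [coeff_mul_single]
        exact I.mul_mem_right _ _ (hy _))
  have hJ : ∀ x, x ∈ J ↔ ∀ g, coeff σ g x ∈ I := fun x => TwoSidedIdeal.mem_mk' _ _ _ _ _ _ _
  rcases eq_bot_or_eq_top J with h | h
  · left
    rw [eq_bot_iff]
    intro t ht
    have : single σ 1 t ∈ J := (hJ _).2 fun g => by
      by_cases hg : g = 1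
      · rw [hg, coeff_single_self]; exact ht
      · rw [coeff_single_of_ne _ hg]; exact I.zero_mem
    rw [h, TwoSidedIdeal.mem_bot] at this
    rw [TwoSidedIdeal.mem_bot, ← coeff_single_self (σ := σ) 1 t, this, map_zero]
  · right
    rw [← I.one_mem_iff, ← coeff_one_self (σ := σ)]
    exact (hJ 1).1 (J.one_mem h) 1

theorem exists_mul_eq_one_of_isSimpleRing [IsSimpleRing (SkewGroupRing σ)] {z : SkewGroupRing σ}
    (hz : z ∈ Subring.center (SkewGroupRing σ)) (h0 : z ≠ 0) : ∃ c, z * c = 1 := by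
  have h : IsMulCentral z := hz
  let J : TwoSidedIdeal (SkewGroupRing σ) := TwoSidedIdeal.mk' {x | ∃ y, x = z * y} ⟨0, by simp⟩
    (by rintro _ _ ⟨s, rfl⟩ ⟨t, rfl⟩; exact ⟨s + t, by rw [mul_add]⟩)
    (by rintro _ ⟨s, rfl⟩; exact ⟨-s, by rw [mul_neg]⟩)
    (by rintro x _ ⟨s, rfl⟩; exact ⟨x * s, h.left_comm _ _ |>.symm⟩)
    (by rintro _ y ⟨s, rfl⟩; exact ⟨s * y, (h.left_assoc _ _).symm⟩)
  have hJ : ∀ x, x ∈ J ↔ ∃ y, x = z * y := fun x => TwoSidedIdeal.mem_mk' _ _ _ _ _ _ _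
  rcases eq_bot_or_eq_top J with h | h
  · refine absurd ?_ h0
    have : z ∈ J := (hJ z).2 ⟨1, (mul_one z).symm⟩
    rwa [h, TwoSidedIdeal.mem_bot] at this
  · obtain ⟨c, hc⟩ := (hJ 1).1 (J.one_mem h)
    exact ⟨c, hc.symm⟩

theorem nontrivial_of_nontrivial [Nontrivial T] : Nontrivial (SkewGroupRing σ) :=
  ⟨1, 0, fun h => one_ne_zero (α := T) <| by rw [← coeff_one_self (σ := σ), h, map_zero]⟩

theorem isDomain_center_of_isSimpleRing [IsSimpleRing (SkewGroupRing σ)] :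
    IsDomain (Subring.center (SkewGroupRing σ)) := by
  have := nontrivial_of_isSimpleRing (σ := σ)
  have := nontrivial_of_nontrivial (σ := σ)
  have : Nontrivial (Subring.center (SkewGroupRing σ)) :=
    ⟨1, 0, fun h => one_ne_zero (α := SkewGroupRing σ) (congrArg Subtype.val h)⟩
  have : NoZeroDivisors (Subring.center (SkewGroupRing σ)) := ⟨by
    intro z w hzw
    by_contra! h
    have hz : IsMulCentral z.1 := z.2
    have hw : IsMulCentral w.1 := w.2
    obtain ⟨c, hc⟩ := exists_mul_eq_one_of_isSimpleRing z.2 fun h0 => h.1 (Subtype.ext h0)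
    have h0 : z.1 * w.1 = 0 := congrArg Subtype.val hzw
    apply h.2
    ext1
    -- `w = (zc)w = z(wc) = (zw)c`, using only the centrality of `z` and `w`, not of `c`.
    rw [← one_mul w.1, ← hc, hw.right_assoc, ← (hw.comm _).eq, hz.left_assoc, h0, zero_mul]
    rfl⟩
  exact NoZeroDivisors.to_isDomain _

/-- If `σ_g` is conjugation by `u`, then `a = u⁻¹` works, with `b = u`. -/
theorem exists_isTwistedCentral_of_mem_conjSubgroup {g : G} (hg : g ∈ conjSubgroup σ) :
    ∃ a b, IsTwistedCentral σ g a ∧ (∀ t, b * (a * t) = t) ∧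
      ∀ t, σ g t = b * t * a := by
  obtain ⟨u, hu, v, hv, huv, hvu, H⟩ := hg
  have hu1 := (mem_nucleus.1 hu.1).1
  have hv1 := (mem_nucleus.1 hv.1).1
  refine ⟨v, u, ⟨hv, fun t => ?_⟩, fun t => ?_, H⟩
  · rw [H, hu1, ← hv1, hvu, one_mul]
  · rw [← hu1, huv, one_mul]

/-- A central element `1 + a u_g` with `g` of infinite order has no inverse. -/
theorem isMulTorsion_conjSubgroup_of_isSimpleRing [IsSimpleRing (SkewGroupRing σ)] :
    IsMulTorsion (conjSubgroup σ) := by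
  have := nontrivial_of_isSimpleRing (σ := σ)
  rintro ⟨g, hg⟩
  rw [← Submonoid.isOfFinOrder_coe]
  by_contra hfin
  have hinj : Function.Injective fun n : ℤ => g ^ n := injective_zpow_iff_not_isOfFinOrder.2 hfin
  obtain ⟨a, b, ha, hba, -⟩ := exists_isTwistedCentral_of_mem_conjSubgroup hg
  have hg1 : (1 : G) ≠ g := fun h => hfin (h ▸ IsOfFinOrder.one)
  obtain ⟨c, hc⟩ := exists_mul_eq_one_of_isSimpleRing
    (add_mem (one_mem _) (single_mem_center ha)) (fun h => one_ne_zero (α := T) <| by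
      simpa [coeff_one_self, coeff_single_of_ne a hg1] using congrArg (coeff σ 1) h)
  have key : ∀ h, coeff σ h c + a * σ g (coeff σ (g⁻¹ * h) c) = coeff σ h 1 := fun h => by
    rw [← hc, add_mul, one_mul, map_add, coeff_single_mul]
  -- Away from degree one, `(1 + a u_g) c = 1` reads `c_n = -a σ_g(c_{n-1})` along the powers of
  -- `g`. As `a` is left-cancellable, vanishing passes both ways, but not across `n = 0`.
  have hstep : ∀ n : ℤ, n ≠ 0 →
      (coeff σ (g ^ n) c = 0 ↔ coeff σ (g ^ (n - 1)) c = 0) := fun n hn => by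
    have h1 : g ^ n ≠ 1 := fun h => hn (hinj (by simpa using h))
    have h := key (g ^ n)
    rw [coeff_one_of_ne h1, ← zpow_neg_one, ← zpow_add, show (-1 + n) = n - 1 by ring] at h
    constructor
    · intro h0
      rw [h0, zero_add] at h
      have := congrArg (b * ·) h
      simpa [hba] using this
    · intro h0
      simpa [h0] using h
  have hfinite : {n : ℤ | coeff σ (g ^ n) c ≠ 0}.Finite :=
    (finite_coeff_ne_zero c).preimage hinj.injOn
  obtain ⟨M, hM⟩ := hfinite.bddAbove
  obtain ⟨m, hm⟩ := hfinite.bddBelow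
  have hup : ∀ n : ℕ, coeff σ (g ^ (n : ℤ)) c = 0 → coeff σ (g ^ (0 : ℤ)) c = 0 := fun n => by
    induction n with
    | zero => exact id
    | succ n ih => exact fun h => ih (by simpa using (hstep (n + 1 : ℕ) (by positivity)).1 h)
  have hdown : ∀ n : ℕ, coeff σ (g ^ (-1 - n : ℤ)) c = 0 → coeff σ (g ^ (-1 : ℤ)) c = 0 :=
    fun n => by
      induction n with
      | zero => simp
      | succ n ih =>
        intro h
        refine ih ((hstep _ (by omega)).2 ?_)
        rwa [show (-1 - n - 1 : ℤ) = -1 - ((n + 1 : ℕ) : ℤ) by push_cast; ring]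
  -- Start just outside the support of `c` on each side and move inwards, to `n = 0` and `n = -1`;
  -- the equation in degree one then becomes `0 = 1`.
  have h0 := hup (M.toNat + 1) (by
    by_contra h
    have := hM h
    omega)
  have h1 := hdown (-m).toNat (by
    by_contra h
    have := hm h
    omega)
  have := key 1
  rw [coeff_one_self, mul_one, ← zpow_neg_one, h1, ← zpow_zero g, h0] at this
  simp at this

/-- If `σ_g = 1` then `u_g - 1` is killed by the augmentation map. -/
theorem conjSubgroup_eq_bot_of_isSimpleRing [IsSimpleRing (SkewGroupRing σ)]
    (hT : ∀ a b : T, a * b = b * a) : conjSubgroup σ = ⊥ := by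
  have := nontrivial_of_isSimpleRing (σ := σ)
  rw [eq_bot_iff]
  intro g hg
  obtain ⟨a, b, ha, hba, H⟩ := exists_isTwistedCentral_of_mem_conjSubgroup hg
  have hσ : ∀ t, σ g t = t := fun t => by
    rw [H, (mem_nucleus.1 ha.mem.1).2.2, hT t, hba]
  by_contra hg1
  rw [Subgroup.mem_bot] at hg1
  have h1 : IsTwistedCentral σ g 1 := ⟨one_mem _, fun t => by rw [hσ, hT]⟩
  obtain ⟨c, hc⟩ := exists_mul_eq_one_of_isSimpleRing
    (sub_mem (single_mem_center h1) (one_mem _)) (fun h => one_ne_zero (α := T) <| by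
      simpa [coeff_one_of_ne hg1, coeff_single_self] using congrArg (coeff σ g) h)
  let ε : SkewGroupRing σ →+ T := Finsupp.liftAddHom fun _ => AddMonoidHom.id T
  have hε : ∀ h t, ε (single σ h t) = t := fun h t => by
    simp only [ε, single]
    exact (Finsupp.liftAddHom_apply_single _ _ _).trans rfl
  -- The sum of coefficients need not be multiplicative, but `σ_g = 1` suffices for multiplication
  -- by `u_g`.
  have hεg : ∀ x, ε (single σ g 1 * x) = ε x := fun x => by
    induction x using induction_on with
    | zero => simp
    | add x y hx hy => rw [mul_add, map_add, map_add, hx, hy]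
    | single h t => rw [single_mul_single, hε, hε, hσ, one_mul]
  have := congrArg ε hc
  rw [sub_mul, one_mul, map_sub, hεg, sub_self, one_def, hε] at this
  exact zero_ne_one this

/-! ### The centre over its degree-one subfield -/

/-- The central elements of the form `a u_1`. -/
def centerDegreeOne (σ : G →* RingAut T) : Subring (Subring.center (SkewGroupRing σ)) where
  carrier := {z | ∃ a, z.1 = single σ 1 a}
  zero_mem' := ⟨0, (single_zero 1).symm⟩
  one_mem' := ⟨1, rfl⟩
  add_mem' := by
    rintro x y ⟨a, ha⟩ ⟨b, hb⟩
    exact ⟨a + b, by rw [single_add, ← ha, ← hb]; rfl⟩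
  neg_mem' := by
    rintro x ⟨a, ha⟩
    refine ⟨-a, (congrArg (- ·) ha).trans (neg_eq_of_add_eq_zero_left ?_)⟩
    rw [← single_add, neg_add_cancel, single_zero]
  mul_mem' := by
    rintro x y ⟨a, ha⟩ ⟨b, hb⟩
    refine ⟨a * b, ?_⟩
    have := single_mul_single σ 1 1 a b
    rw [map_one, RingAut.one_apply, mul_one] at this
    rw [← this, ← ha, ← hb]
    rfl

theorem exists_center_mul_single_eq_one (hT : IsGSimple σ) {g : G} {a : T}
    (ha : IsTwistedCentral σ g a) (h0 : a ≠ 0) :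
    ∃ b, IsTwistedCentral σ g⁻¹ b ∧ single σ g a * single σ g⁻¹ b = 1 := by
  obtain ⟨b, hab, hba⟩ := ha.exists_inverse hT h0
  have hb := ha.inverse hab hba
  exact ⟨b, hb, by rw [single_mul_single, hb.mem.2, hab, mul_inv_cancel, one_def]⟩

theorem isField_centerDegreeOne (hT : IsGSimple σ) : IsField (centerDegreeOne σ) where
  exists_pair_ne := by
    have := hT.1
    have := nontrivial_of_nontrivial (σ := σ)
    exact ⟨0, 1, fun h => zero_ne_one (α := SkewGroupRing σ)
      (congrArg Subtype.val (congrArg Subtype.val h))⟩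
  mul_comm := mul_comm
  mul_inv_cancel := by
    rintro ⟨z, a, ha⟩ hz
    have hta : IsTwistedCentral σ 1 a := by
      have := isTwistedCentral_coeff_of_mem_center z.2 1
      rwa [ha, coeff_single_self] at this
    have h0 : a ≠ 0 := by
      rintro rfl
      exact hz (Subtype.ext (Subtype.ext (ha.trans (single_zero 1))))
    obtain ⟨b, hb, hab⟩ := exists_center_mul_single_eq_one hT hta h0
    refine ⟨⟨⟨_, single_mem_center hb⟩, b, congrArg (single σ · b) inv_one⟩, Subtype.ext (Subtype.ext ?_)⟩
    rw [← ha] at hab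
    exact hab

theorem single_pow_mem (z : Subring.center (SkewGroupRing σ)) {g : G} {a : T}
    (hz : z.1 = single σ g a) (n : ℕ) : ∃ b, (z ^ n).1 = single σ (g ^ n) b := by
  induction n with
  | zero => exact ⟨1, by rw [pow_zero, pow_zero]; rfl⟩
  | succ n ih =>
    obtain ⟨b, hb⟩ := ih
    refine ⟨b * σ (g ^ n) a, ?_⟩
    rw [pow_succ, pow_succ, ← single_mul_single, ← hb, ← hz]
    rfl

/-- A central element is a sum of homogeneous central ones with degrees in `L`; torsion gives each
of these a positive power in degree one. -/
theorem isIntegral_centerDegreeOne (hT : IsGSimple σ) (hL : IsMulTorsion (conjSubgroup σ)) :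
    Algebra.IsIntegral (centerDegreeOne σ) (Subring.center (SkewGroupRing σ)) := ⟨fun z => by
  have hc := isTwistedCentral_coeff_of_mem_center z.2
  have hsum : z = ∑ g ∈ (finite_coeff_ne_zero z.1).toFinset,
      (⟨single σ g (coeff σ g z.1), single_mem_center (hc g)⟩ :
        Subring.center (SkewGroupRing σ)) := by
    ext1
    rw [AddSubmonoidClass.coe_finsetSum]
    exact eq_sum_single z.1
  rw [hsum]
  refine IsIntegral.sum _ fun g hg => ?_
  obtain ⟨n, hn, h⟩ := isOfFinOrder_iff_pow_eq_one.1
    (hL ⟨g, (hc g).mem_conjSubgroup hT (by simpa using hg)⟩)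
  obtain ⟨b, hb⟩ := single_pow_mem
    ⟨single σ g (coeff σ g z.1), single_mem_center (hc g)⟩ rfl n
  rw [show g ^ n = 1 from congrArg Subtype.val h] at hb
  exact IsIntegral.of_pow hn (isIntegral_algebraMap (x := (⟨_, b, hb⟩ : centerDegreeOne σ)))⟩

/-! ### Central elements in ideals, by minimal support -/

/-- A non-zero ideal of the skew group ring of a `G`-simple ring contains a non-zero central
element: an element of minimal support with coefficient `1` at `u_1`. -/
theorem exists_mem_center_of_ne_bot (hT : IsGSimple σ) {J : TwoSidedIdeal (SkewGroupRing σ)}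
    (hJ : J ≠ ⊥) : ∃ z ∈ J, z ≠ 0 ∧ z ∈ Subring.center (SkewGroupRing σ) := by
  have := hT.1
  let supp : SkewGroupRing σ → Finset G := fun x => (finite_coeff_ne_zero x).toFinset
  have hsupp : ∀ x g, g ∈ supp x ↔ coeff σ g x ≠ 0 := fun x g => by simp [supp]
  -- Right multiplication by `u_{g⁻¹}` translates the support, moving `g` to the identity.
  have shift : ∀ x ∈ J, ∀ g, coeff σ g x ≠ 0 →
      ∃ y ∈ J, coeff σ 1 y ≠ 0 ∧ (supp y).card ≤ (supp x).card := by
    intro x hx g hg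
    refine ⟨x * single σ g⁻¹ 1, J.mul_mem_right _ _ hx, by simpa [coeff_mul_single] using hg,
      Finset.card_le_card_of_injOn (· * g) (fun h hh => ?_) (mul_left_injective g).injOn⟩
    simpa [hsupp, coeff_mul_single] using hh
  have hne : {x | x ∈ J ∧ coeff σ 1 x ≠ 0}.Nonempty := by
    by_contra hempty
    refine hJ (eq_bot_iff.2 fun x hx => ?_)
    rw [TwoSidedIdeal.mem_bot]
    by_contra hx0
    obtain ⟨g, hg⟩ : ∃ g, coeff σ g x ≠ 0 := by
      by_contra! h
      exact hx0 (ext fun g => by rw [h, map_zero])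
    obtain ⟨y, hy, hy1, -⟩ := shift x hx g hg
    exact hempty ⟨y, hy, hy1⟩
  obtain ⟨r, ⟨hr, hr1⟩, hmin⟩ :=
    (measure fun x : SkewGroupRing σ => (supp x).card).wf.has_min _ hne
  -- Such a `y`, if non-zero, has strictly smaller support than `r`, and a translate of it
  -- contradicts minimality.
  have hzero : ∀ y ∈ J, (∀ h, coeff σ h r = 0 → coeff σ h y = 0) → coeff σ 1 y = 0 → y = 0 := by
    intro y hy hyr hy1
    refine ext fun g => ?_
    rw [map_zero]
    by_contra hg
    obtain ⟨x, hx, hx1, hxy⟩ := shift y hy g hg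
    refine hmin x ⟨hx, hx1⟩ (hxy.trans_lt (Finset.card_lt_card
      ((Finset.ssubset_iff_of_subset fun h hh => ?_).2 ⟨1, ?_⟩)))
    · rw [hsupp] at hh ⊢
      exact fun h0 => hh (hyr h h0)
    · rw [hsupp, hsupp]
      exact ⟨hr1, not_not.2 hy1⟩
  -- Degree-one coefficients of elements of `J` supported inside the support of `r`. Conjugation by
  -- `u_g` makes this ideal invariant, so it contains `1`.
  let I : TwoSidedIdeal T := TwoSidedIdeal.mk'
    {t | ∃ y ∈ J, (∀ h, coeff σ h r = 0 → coeff σ h y = 0) ∧ coeff σ 1 y = t}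
    ⟨0, J.zero_mem, by simp, by simp⟩
    (by
      rintro _ _ ⟨y, hy, h, rfl⟩ ⟨y', hy', h', rfl⟩
      exact ⟨y + y', J.add_mem hy hy', fun g hg => by rw [map_add, h g hg, h' g hg, add_zero],
        map_add _ _ _⟩)
    (by
      rintro _ ⟨y, hy, h, rfl⟩
      exact ⟨-y, J.neg_mem hy, fun g hg => by rw [map_neg, h g hg, neg_zero], map_neg _ _⟩)
    (by
      rintro t _ ⟨y, hy, h, rfl⟩
      exact ⟨single σ 1 t * y, J.mul_mem_left _ _ hy,
        fun g hg => by rw [coeff_single_one_mul, h g hg, mul_zero], coeff_single_one_mul _ _ _⟩)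
    (by
      rintro _ t ⟨y, hy, h, rfl⟩
      exact ⟨y * single σ 1 t, J.mul_mem_right _ _ hy,
        fun g hg => by rw [coeff_mul_single_one, h g hg, zero_mul],
        by rw [coeff_mul_single_one, map_one, RingAut.one_apply]⟩)
  have hI : ∀ t, t ∈ I ↔ ∃ y ∈ J, (∀ h, coeff σ h r = 0 → coeff σ h y = 0) ∧ coeff σ 1 y = t :=
    fun x => TwoSidedIdeal.mem_mk' _ _ _ _ _ _ _
  have hItop : I = ⊤ := by
    refine (hT.2 I ?_).resolve_left fun h => hr1 ?_
    · intro g t ht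
      obtain ⟨y, hy, h, rfl⟩ := (hI t).1 ht
      exact (hI _).2 ⟨single σ g 1 * y * single σ g⁻¹ 1,
        J.mul_mem_right _ _ (J.mul_mem_left _ _ hy),
        fun k hk => by rw [coeff_conj, h k hk, map_zero], coeff_conj _ _ _⟩
    · rw [← TwoSidedIdeal.mem_bot, ← h]
      exact (hI _).2 ⟨r, hr, fun _ => id, rfl⟩
  obtain ⟨z, hz, hzr, hz1⟩ := (hI 1).1 (I.one_mem hItop)
  -- Elements of `J` supported inside the support of `z` are determined by their coefficient at
  -- `u_1`. The identities making `z` central thus need checking only there, where `z` has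
  -- coefficient `1`.
  have key : ∀ x ∈ J, ∀ y ∈ J, (∀ h, coeff σ h z = 0 → coeff σ h x = 0) →
      (∀ h, coeff σ h z = 0 → coeff σ h y = 0) → coeff σ 1 x = coeff σ 1 y → x = y :=
    fun x hx y hy hxz hyz h1 => sub_eq_zero.1 <| hzero _ (J.sub_mem hx hy)
      (fun h hh => by rw [map_sub, hxz h (hzr h hh), hyz h (hzr h hh), sub_self])
      (by rw [map_sub, h1, sub_self])
  have hl : ∀ {x} s, x ∈ J → s * x ∈ J := fun s hx => J.mul_mem_left _ _ hx
  have hr : ∀ {x} s, x ∈ J → x * s ∈ J := fun s hx => J.mul_mem_right _ _ hx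
  refine ⟨z, hz, fun h => one_ne_zero (α := T) (by rw [← hz1, h, map_zero]),
    mem_center_of_coeff (isTwistedCentral_coeff (fun g => ?_) (fun t => ?_) (fun s t => ?_)
      (fun s t => ?_) fun s t => ?_)⟩
  · exact key _ (hr _ (hl _ hz)) _ hz (fun h hh => by rw [coeff_conj, hh, map_zero])
      (fun _ => id) (by rw [coeff_conj, hz1, map_one])
  · exact key _ (hl _ hz) _ (hr _ hz) (fun h hh => by simp [coeff_single_one_mul, hh])
      (fun h hh => by simp [coeff_mul_single_one, hh])
      (by simp [coeff_single_one_mul, coeff_mul_single_one, hz1])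
  · exact key _ (hr _ (hr _ hz)) _ (hr _ hz) (fun h hh => by simp [coeff_mul_single_one, hh])
      (fun h hh => by simp [single_mul_single, coeff_mul_single_one, hh])
      (by simp [single_mul_single, coeff_mul_single_one, hz1])
  · exact key _ (hr _ (hl _ hz)) _ (hl _ (hr _ hz))
      (fun h hh => by simp [coeff_single_one_mul, coeff_mul_single_one, hh])
      (fun h hh => by simp [coeff_single_one_mul, coeff_mul_single_one, hh])
      (by simp [coeff_single_one_mul, coeff_mul_single_one, hz1])
  · exact key _ (hl _ hz) _ (hl _ (hl _ hz))
      (fun h hh => by simp [single_mul_single, coeff_single_one_mul, hh])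
      (fun h hh => by simp [coeff_single_one_mul, hh])
      (by simp [single_mul_single, coeff_single_one_mul, hz1])

/-! ### Sufficiency and the main theorem -/

theorem isSimpleRing_of_isGSimple (hT : IsGSimple σ)
    [IsDomain (Subring.center (SkewGroupRing σ))] (hL : IsMulTorsion (conjSubgroup σ)) :
    IsSimpleRing (SkewGroupRing σ) := by
  have := hT.1
  have := nontrivial_of_nontrivial (σ := σ)
  have := isIntegral_centerDegreeOne hT hL
  have hF := isField_of_isIntegral_of_isField' (S := Subring.center (SkewGroupRing σ))
    (isField_centerDegreeOne hT)
  refine ⟨{ exists_pair_ne := ⟨⊥, ⊤, fun h => ?_⟩, eq_bot_or_eq_top := fun J => ?_ }⟩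
  · refine one_ne_zero (α := SkewGroupRing σ) ?_
    rw [← TwoSidedIdeal.mem_bot, h, TwoSidedIdeal.one_mem_iff]
  · refine or_iff_not_imp_left.2 fun hJ => ?_
    obtain ⟨z, hz, hz0, hzc⟩ := exists_mem_center_of_ne_bot hT hJ
    obtain ⟨c, hc⟩ := hF.mul_inv_cancel
      (a := ⟨z, hzc⟩) fun h => hz0 (congrArg Subtype.val h)
    rw [← J.one_mem_iff, show (1 : SkewGroupRing σ) = z * c.1 from (congrArg Subtype.val hc).symm]
    exact J.mul_mem_right _ _ hz

/-- Degrees occurring in the centre lie in `L`, so the whole centre is its degree-one subfield. -/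
theorem isDomain_center_of_conjSubgroup_eq_bot (hT : IsGSimple σ) (hL : conjSubgroup σ = ⊥) :
    IsDomain (Subring.center (SkewGroupRing σ)) := by
  have hmem : ∀ z, z ∈ centerDegreeOne σ := fun z => by
    refine ⟨coeff σ 1 z.1, ext fun g => ?_⟩
    by_cases hg : g = 1
    · rw [hg, coeff_single_self]
    · rw [coeff_single_of_ne _ hg]
      by_contra h0
      have := (isTwistedCentral_coeff_of_mem_center z.2 g).mem_conjSubgroup hT h0
      rw [hL] at this
      exact hg this
  have := (isField_centerDegreeOne hT).isDomain
  exact MulEquiv.isDomain (centerDegreeOne σ)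
    ((RingEquiv.subringCongr (Subring.eq_top_iff' _ |>.2 hmem)).trans Subring.topEquiv).symm.toMulEquiv

end SkewGroupRing

theorem mainTheorem6 {T G : Type*} [NonAssocRing T] [CommGroup G] (σ : G →* RingAut T) :
    (IsSimpleRing (SkewGroupRing σ) ↔
      NASkew.IsGSimple σ ∧ IsDomain (Subring.center (SkewGroupRing σ)) ∧
        IsMulTorsion (NASkew.conjSubgroup σ)) ∧
    ((∀ a b : T, a * b = b * a) →
      (IsSimpleRing (SkewGroupRing σ) ↔ NASkew.IsGSimple σ ∧ NASkew.conjSubgroup σ = ⊥)) := by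
  refine ⟨⟨fun h => ⟨SkewGroupRing.isGSimple_of_isSimpleRing,
    SkewGroupRing.isDomain_center_of_isSimpleRing,
    SkewGroupRing.isMulTorsion_conjSubgroup_of_isSimpleRing⟩,
    fun ⟨hT, _, hL⟩ => SkewGroupRing.isSimpleRing_of_isGSimple hT hL⟩,
    fun hc => ⟨fun h => ⟨SkewGroupRing.isGSimple_of_isSimpleRing,
      SkewGroupRing.conjSubgroup_eq_bot_of_isSimpleRing hc⟩, fun ⟨hT, hL⟩ => ?_⟩⟩
  -- A trivial `L` is torsion, so this direction of (b) reduces to (a) once the centre is a domain.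
  have := SkewGroupRing.isDomain_center_of_conjSubgroup_eq_bot hT hL
  refine SkewGroupRing.isSimpleRing_of_isGSimple hT ?_
  rintro ⟨g, hg⟩
  obtain rfl : g = 1 := by rwa [hL] at hg
  exact IsOfFinOrder.one
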